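/- There exist absolute constants $C,c>0$ such that the following holds. Let $n,m\in\mathbb N$, let $0<s\le n$ be real, let $\delta>0$, and put $K_{n,s}=\{x\in\mathbb R^n:\ \|x\|_2\le 1,\ \|x\|_1\le\sqrt s\}$. Let $a_1,\dots,a_m$ be independent standard Gaussian random vectors in $\mathbb R^n$, and fix $x\in K_{n,s}$ with $\|x\|_2=1$. Let $y_1,\dots,y_m$ be $\{-1,1\}$-valued random variables which are conditionally independent given $\{a_1,\dots,a_m\}$ and satisfy $$\mathbb E\big[y_i\mid a_1,\dots,a_m\big]=\theta(\langle a_i,x\rangle)\quad\text{almost surely},\qquad i=1,\dots,m,$$ for some measurable function $\theta:\mathbb R\to\mathbb R$ (which may be unknown) with $\lambda:=\mathbb E\,\theta(g)g>0$, where $g$ is a standard normal random variable. Suppose that $$m\ \ge\ C\,\delta^{-2}\,s\log(2n/s).$$ Then with probability at least $1-8\exp(-c\,\delta^2 m)$ the convex program $$\max\ \sum_{i=1}^m y_i\langle a_i,x'\rangle\quad\text{subject to}\quad \|x'\|_1\le\sqrt s\ \text{ and }\ \|x'\|_2\le 1$$ has a solution, and every solution $\hat x$ of it satisfies $\|\hat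 x-x\|_2^2\le\delta/\lambda$. -/

import Mathlib

open MeasureTheory ProbabilityTheory
open scoped RealInnerProductSpace

noncomputable section

/-- The set `K_{n,s} = B₂ⁿ ∩ √s B₁ⁿ` of compressible signals. -/
def compressibleSet (n : ℕ) (s : ℝ) : Set (EuclideanSpace ℝ (Fin n)) :=
  {x | ‖x‖ ≤ 1 ∧ ∑ j, |x j| ≤ √s}

/-- The correlation coefficient `λ = 𝔼 θ(g) g`, where `g` is a standard normal variable. -/
def linkCorrelation (θ : ℝ → ℝ) : ℝ :=
  ∫ z, θ z * z ∂(gaussianReal 0 1)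

/-- The σ-algebra generated by all the random vectors `a i`. -/
abbrev measurementSigma {Ω : Type*} {n m : ℕ} (a : Fin m → Ω → EuclideanSpace ℝ (Fin n)) :
    MeasurableSpace Ω :=
  MeasurableSpace.comap (fun ω i => a i ω) inferInstance

/-- The real random variables `y i` are independent conditionally on the σ-algebra `𝒢`
(on an arbitrary probability space, which need not be standard Borel). -/
def CondIndependent {Ω ι : Type*} [MeasurableSpace Ω] (μ : Measure Ω) (𝒢 : MeasurableSpace Ω)
    (y : ι → Ω → ℝ) : Prop :=
  ∀ (S : Finset ι) (B : ι → Set ℝ), (∀ i ∈ S, MeasurableSet (B i)) →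
    μ⟦⋂ i ∈ S, y i ⁻¹' B i | 𝒢⟧ =ᵐ[μ] ∏ i ∈ S, μ⟦y i ⁻¹' B i | 𝒢⟧

/-- The noisy one-bit (generalized linear) measurement model with Gaussian measurement vectors `a i`,
responses `y i`, signal `x` and inverse link function `θ`. -/
structure IsOneBitModel {Ω : Type*} [MeasurableSpace Ω] (μ : Measure Ω) {n m : ℕ}
    (θ : ℝ → ℝ) (x : EuclideanSpace ℝ (Fin n))
    (a : Fin m → Ω → EuclideanSpace ℝ (Fin n)) (y : Fin m → Ω → ℝ) : Prop where
  /-- The `a i` are random vectors. -/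
  measurable_a : ∀ i, Measurable (a i)
  /-- Each `a i` is a standard Gaussian vector in `ℝⁿ`. -/
  law_a : ∀ i, HasLaw (a i) (stdGaussian (EuclideanSpace ℝ (Fin n))) μ
  /-- The `a i` are independent. -/
  indep_a : iIndepFun a μ
  /-- The `y i` are random variables. -/
  measurable_y : ∀ i, Measurable (y i)
  /-- The `y i` take values in `{-1, 1}` almost surely. -/
  sign_y : ∀ i, ∀ᵐ ω ∂μ, y i ω = -1 ∨ y i ω = 1
  /-- Given `{a i}`, the `y i` are independent. -/
  condIndep_y : CondIndependent μ (measurementSigma a) y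
  /-- Given `{a i}`, the mean of `y i` is `θ(⟨a i, x⟩)`. -/
  condMean_y : ∀ i, μ[y i | measurementSigma a] =ᵐ[μ] fun ω => θ ⟪a i ω, x⟫

/-- `xhat` solves the convex program: maximize `∑ᵢ bᵢ ⟨vᵢ, x'⟩` subject to
`‖x'‖₁ ≤ √s` and `‖x'‖₂ ≤ 1`. -/
def IsProgramSolution {n m : ℕ} (s : ℝ) (v : Fin m → EuclideanSpace ℝ (Fin n)) (b : Fin m → ℝ)
    (xhat : EuclideanSpace ℝ (Fin n)) : Prop :=
  xhat ∈ compressibleSet n s ∧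
    IsMaxOn (fun x' => ∑ i, b i * ⟪v i, x'⟫) (compressibleSet n s) xhat

end

/-!
Multiply the component of `a i` orthogonal to the signal `x` by the sign `y i`. The conditional mean
of `y i` depends only on `⟪a i, x⟫`, and the standard Gaussian law is invariant under the reflection
in the line spanned by `x`, so the flipped vectors are again independent standard Gaussian vectors.
The objective at `z` is the empirical correlation `∑ i, y i * ⟪a i, x⟫`, whose mean is `m λ`, times
`⟪x, z⟫`, up to an error controlled by the inner products of `z` and `x` with the sum `w` of the
flipped vectors. The correlation is sub-Gaussian because its summands are dominated by
`|⟪a i, x⟫|`. For `w / √m`, a standard Gaussian vector, soft thresholding of the coordinates at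
level `T = 2 √(log (2n/s))` splits the supremum over `K_{n,s}` into `T √s`, absorbed by the `ℓ¹`
constraint, and the Euclidean norm of the excesses over `T`, which has Gaussian tails.
Once both errors are at most `m δ / 8`, a maximizer cannot be farther from `x` than claimed, since
`‖z - x‖² ≤ 2 (1 - ⟪x, z⟫)` on the unit ball.
-/

section CondExp

variable {Ω ι E : Type*} {𝒢 mΩ : MeasurableSpace Ω} [MeasurableSpace E] {μ : Measure Ω}

theorem measureReal_inter_eq_setIntegral_condExp [IsFiniteMeasure μ] (h𝒢 : 𝒢 ≤ mΩ) {U V : Set Ω}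
    (hU : MeasurableSet[𝒢] U) (hV : MeasurableSet V) :
    μ.real (U ∩ V) = ∫ ω in U, (μ⟦V | 𝒢⟧) ω ∂μ := by
  rw [setIntegral_condExp h𝒢 ((integrable_const _).indicator hV) hU, setIntegral_indicator hV,
    setIntegral_const, smul_eq_mul, mul_one]

theorem integral_mul_eq_integral_mul_of_condExp_ae_eq [IsFiniteMeasure μ] (h𝒢 : 𝒢 ≤ mΩ)
    {y ρ g : Ω → ℝ} (hρ : μ[y | 𝒢] =ᵐ[μ] ρ) (hg : StronglyMeasurable[𝒢] g)
    (hy : Integrable y μ) (hyg : Integrable (fun ω => y ω * g ω) μ) :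
    ∫ ω, y ω * g ω ∂μ = ∫ ω, ρ ω * g ω ∂μ := by
  rw [← integral_condExp h𝒢]
  refine integral_congr_ae ?_
  filter_upwards [condExp_mul_of_stronglyMeasurable_right hg hyg hy, hρ] with ω hpull hω
  exact hpull.trans (congrArg (· * g ω) hω)

theorem integral_finset_prod_comp_of_iIndepFun {a : ι → Ω → E} (ha : iIndepFun a μ)
    (ham : ∀ i, AEMeasurable (a i) μ) {S : Finset ι} {f : ι → E → ℝ}
    (hf : ∀ i ∈ S, Measurable (f i)) :
    ∫ ω, ∏ i ∈ S, f i (a i ω) ∂μ = ∏ i ∈ S, ∫ ω, f i (a i ω) ∂μ := by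
  simp_rw [← Finset.prod_coe_sort S]
  exact (ha.precomp Subtype.val_injective).integral_fun_prod_comp (fun i => ham i)
    (fun i => (hf i i.2).aestronglyMeasurable)

theorem measureReal_preimage_inter_eq_integral_indicator [IsFiniteMeasure μ] (h𝒢 : 𝒢 ≤ mΩ)
    {a : Ω → E} (ha : Measurable[𝒢] a) {A : Set E} (hA : MeasurableSet A) {V : Set Ω}
    (hV : MeasurableSet V) {φ : E → ℝ} (hφ : μ⟦V | 𝒢⟧ =ᵐ[μ] fun ω => φ (a ω)) :
    μ.real (a ⁻¹' A ∩ V) = ∫ ω, A.indicator φ (a ω) ∂μ := by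
  rw [measureReal_inter_eq_setIntegral_condExp h𝒢 (ha hA) hV,
    integral_congr_ae (ae_restrict_of_ae hφ), ← integral_indicator (h𝒢 _ (ha hA))]
  rfl

namespace CondIndependent

variable [IsProbabilityMeasure μ] {a : ι → Ω → E} {y : ι → Ω → ℝ}

theorem measureReal_biInter_preimage_inter (h : CondIndependent μ 𝒢 y) (h𝒢 : 𝒢 ≤ mΩ)
    (ha : ∀ i, Measurable[𝒢] (a i)) (hind : iIndepFun a μ) (hy : ∀ i, Measurable (y i))
    {A : ι → Set E} {B : ι → Set ℝ} {S : Finset ι} (hA : ∀ i ∈ S, MeasurableSet (A i))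
    (hB : ∀ i ∈ S, MeasurableSet (B i))
    (hker : ∀ i ∈ S, ∃ φ : E → ℝ, Measurable φ ∧ μ⟦y i ⁻¹' B i | 𝒢⟧ =ᵐ[μ] fun ω => φ (a i ω)) :
    μ.real (⋂ i ∈ S, (a i ⁻¹' A i ∩ y i ⁻¹' B i)) =
      ∏ i ∈ S, μ.real (a i ⁻¹' A i ∩ y i ⁻¹' B i) := by
  choose! φ hφm hφ using hker
  have hU : MeasurableSet[𝒢] (⋂ i ∈ S, a i ⁻¹' A i) :=
    S.measurableSet_biInter fun i hi => ha i (hA i hi)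
  have hV : MeasurableSet (⋂ i ∈ S, y i ⁻¹' B i) :=
    S.measurableSet_biInter fun i hi => hy i (hB i hi)
  calc μ.real (⋂ i ∈ S, (a i ⁻¹' A i ∩ y i ⁻¹' B i))
      = ∫ ω in ⋂ i ∈ S, a i ⁻¹' A i, (μ⟦⋂ i ∈ S, y i ⁻¹' B i | 𝒢⟧) ω ∂μ := by
        simp_rw [Set.iInter_inter_distrib]
        exact measureReal_inter_eq_setIntegral_condExp h𝒢 hU hV
    _ = ∫ ω, ∏ i ∈ S, (A i).indicator (φ i) (a i ω) ∂μ := by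
        rw [← integral_indicator (h𝒢 _ hU)]
        refine integral_congr_ae ?_
        filter_upwards [h S B hB, (S.eventually_all).2 hφ] with ω hprod hφω
        by_cases hω : ∀ i ∈ S, a i ω ∈ A i
        · rw [Set.indicator_of_mem (Set.mem_iInter₂.2 hω), hprod, Finset.prod_apply]
          refine Finset.prod_congr rfl fun i hi => ?_
          rw [hφω i hi, Set.indicator_of_mem (hω i hi)]
        · rw [Set.indicator_of_notMem (fun hmem => hω (Set.mem_iInter₂.1 hmem))]
          obtain ⟨i, hi, hiA⟩ := by simpa only [not_forall] using hω
          exact (Finset.prod_eq_zero hi (Set.indicator_of_notMem hiA _)).symm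
    _ = ∏ i ∈ S, ∫ ω, (A i).indicator (φ i) (a i ω) ∂μ :=
        integral_finset_prod_comp_of_iIndepFun hind
          (fun i => ((ha i).mono h𝒢 le_rfl).aemeasurable)
          (fun i hi => (hφm i hi).indicator (hA i hi))
    _ = ∏ i ∈ S, μ.real (a i ⁻¹' A i ∩ y i ⁻¹' B i) :=
        Finset.prod_congr rfl fun i hi => (measureReal_preimage_inter_eq_integral_indicator h𝒢
          (ha i) (hA i hi) (hy i (hB i hi)) (hφ i hi)).symm

theorem iIndepFun_prodMk (h : CondIndependent μ 𝒢 y) (h𝒢 : 𝒢 ≤ mΩ)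
    (ha : ∀ i, Measurable[𝒢] (a i)) (hind : iIndepFun a μ) (hy : ∀ i, Measurable (y i))
    (hker : ∀ i (B : Set ℝ), MeasurableSet B →
      ∃ φ : E → ℝ, Measurable φ ∧ μ⟦y i ⁻¹' B | 𝒢⟧ =ᵐ[μ] fun ω => φ (a i ω)) :
    iIndepFun (fun i ω => (a i ω, y i ω)) μ := by
  let rectangles : Set (Set (E × ℝ)) :=
    Set.image2 (· ×ˢ ·) {A | MeasurableSet A} {B | MeasurableSet B}
  refine iIndepSets.iIndep
    (fun i => (((ha i).mono h𝒢 le_rfl).prodMk (hy i)).comap_le)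
    (fun i => {U | ∃ t ∈ rectangles, (fun ω => (a i ω, y i ω)) ⁻¹' t = U})
    (fun i => isPiSystem_prod.comap _) (fun i => ?_) ?_
  · rw [← generateFrom_prod, MeasurableSpace.comap_generateFrom]
    rfl
  · rw [iIndepSets_iff]
    intro S f hf
    have hrect : ∀ i ∈ S, ∃ (A : Set E) (B : Set ℝ), MeasurableSet A ∧ MeasurableSet B ∧
        f i = a i ⁻¹' A ∩ y i ⁻¹' B := by
      intro i hi
      obtain ⟨-, ⟨A, hA, B, hB, rfl⟩, hAB⟩ := hf i hi
      exact ⟨A, B, hA, hB, hAB.symm⟩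
    choose! A B hA hB hAB using hrect
    rw [← ENNReal.toReal_eq_toReal_iff' (measure_ne_top _ _)
      (ENNReal.prod_ne_top fun i _ => measure_ne_top _ _), ENNReal.toReal_prod,
      Set.iInter₂_congr hAB, Finset.prod_congr rfl fun i hi => by rw [hAB i hi]]
    exact h.measureReal_biInter_preimage_inter h𝒢 ha hind hy hA hB
      fun i hi => hker i (B i) (hB i hi)

end CondIndependent

end CondExp

section SignVariable

variable {Ω E : Type*} {𝒢 mΩ : MeasurableSpace Ω} [MeasurableSpace E] {μ : Measure Ω}
  {y : Ω → ℝ}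

theorem integrable_of_sign [IsFiniteMeasure μ] (hy : Measurable y)
    (hsign : ∀ᵐ ω ∂μ, y ω = -1 ∨ y ω = 1) : Integrable y μ := by
  refine .of_bound hy.aestronglyMeasurable 1 ?_
  filter_upwards [hsign] with ω hω
  rcases hω with hω | hω <;> simp [hω]

theorem apply_eq_affine_of_sign (f : ℝ → ℝ) {r : ℝ} (hr : r = -1 ∨ r = 1) :
    f r = (f 1 + f (-1)) / 2 + (f 1 - f (-1)) / 2 * r := by
  rcases hr with rfl | rfl <;> ring

theorem condExp_indicator_preimage_of_sign [IsFiniteMeasure μ] (h𝒢 : 𝒢 ≤ mΩ) (hy : Measurable y)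
    (hsign : ∀ᵐ ω ∂μ, y ω = -1 ∨ y ω = 1) (B : Set ℝ) :
    ∃ p q : ℝ, μ⟦y ⁻¹' B | 𝒢⟧ =ᵐ[μ] fun ω => p + q * (μ[y | 𝒢]) ω := by
  let f : ℝ → ℝ := B.indicator fun _ => 1
  let p := (f 1 + f (-1)) / 2
  let q := (f 1 - f (-1)) / 2
  have hyi := integrable_of_sign hy hsign
  have haffine : (y ⁻¹' B).indicator (fun _ => (1 : ℝ)) =ᵐ[μ] (fun _ => p) + q • y := by
    filter_upwards [hsign] with ω hω
    exact apply_eq_affine_of_sign f hω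
  refine ⟨p, q, ?_⟩
  filter_upwards [condExp_congr_ae (m := 𝒢) haffine,
    condExp_add (integrable_const p) (hyi.smul q) 𝒢, condExp_smul (μ := μ) q y 𝒢]
    with ω hcongr hadd hsmul
  rw [hcongr, hadd, Pi.add_apply, condExp_const h𝒢, hsmul]
  rfl

theorem measureReal_preimage_of_sign [IsFiniteMeasure μ] {a b c : Ω → E} (ha : Measurable a)
    (hb : Measurable b) (hc : Measurable c) (hy : Measurable y)
    (hby : ∀ᵐ ω ∂μ, y ω = 1 ∧ b ω = a ω ∨ y ω = -1 ∧ b ω = c ω) {A : Set E}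
    (hA : MeasurableSet A) :
    μ.real (b ⁻¹' A) = 2⁻¹ * ((μ.real (a ⁻¹' A) + ∫ ω in a ⁻¹' A, y ω ∂μ) +
      (μ.real (c ⁻¹' A) - ∫ ω in c ⁻¹' A, y ω ∂μ)) := by
  classical
  have hyi : Integrable y μ := integrable_of_sign hy (hby.mono fun ω hω => by tauto)
  have hsplit : (b ⁻¹' A).indicator 1 =ᵐ[μ] fun ω =>
      (2⁻¹ : ℝ) * ((a ⁻¹' A).indicator (fun ω => 1 + y ω) ω +
        (c ⁻¹' A).indicator (fun ω => 1 - y ω) ω) := by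
    filter_upwards [hby] with ω hω
    rcases hω with ⟨hyω, hbω⟩ | ⟨hyω, hbω⟩ <;>
      norm_num [Set.indicator_apply, hyω, hbω]
  have hadd : Integrable (fun ω => 1 + y ω) μ := (integrable_const 1).add hyi
  have hsub : Integrable (fun ω => 1 - y ω) μ := (integrable_const 1).sub hyi
  rw [← integral_indicator_one (hb hA), integral_congr_ae hsplit, integral_const_mul,
    integral_add (hadd.indicator (ha hA)) (hsub.indicator (hc hA)),
    integral_indicator (ha hA), integral_indicator (hc hA),
    integral_add (integrable_const 1) hyi.integrableOn,
    integral_sub (integrable_const 1) hyi.integrableOn]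
  simp only [setIntegral_const, smul_eq_mul, mul_one]

theorem hasLaw_of_sign_of_measurePreserving [IsProbabilityMeasure μ] {ν : Measure E}
    (h𝒢 : 𝒢 ≤ mΩ) {a b : Ω → E} (ha : Measurable[𝒢] a) (hlaw : HasLaw a ν μ)
    (hy : Measurable y) (hb : Measurable b) {ψ : E → ℝ} (hψ : Measurable ψ)
    (hmean : μ[y | 𝒢] =ᵐ[μ] fun ω => ψ (a ω)) {R : E → E} (hR : MeasurePreserving R ν ν)
    (hψR : ∀ v, ψ (R v) = ψ v)
    (hby : ∀ᵐ ω ∂μ, y ω = 1 ∧ b ω = a ω ∨ y ω = -1 ∧ b ω = R (a ω)) :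
    HasLaw b ν μ := by
  have hm : Measurable a := ha.mono h𝒢 le_rfl
  have hyi : Integrable y μ := integrable_of_sign hy (hby.mono fun ω hω => by tauto)
  have : IsProbabilityMeasure ν := hlaw.isProbabilityMeasure_iff.1 inferInstance
  refine ⟨hb.aemeasurable, Measure.ext fun A hA => ?_⟩
  have hRA : MeasurableSet (R ⁻¹' A) := hR.measurable hA
  have hmeasure : ∀ {A' : Set E}, MeasurableSet A' → μ.real (a ⁻¹' A') = ν.real A' :=
    fun hA' => by rw [← hlaw.map_eq, map_measureReal_apply hm hA']
  have hintegral : ∀ {A' : Set E}, MeasurableSet A' →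
      ∫ ω in a ⁻¹' A', y ω ∂μ = ∫ v in A', ψ v ∂ν := fun hA' => by
    rw [← setIntegral_condExp h𝒢 hyi (ha hA'), integral_congr_ae (ae_restrict_of_ae hmean),
      ← hlaw.map_eq, setIntegral_map hA' hψ.aestronglyMeasurable hm.aemeasurable]
  have hreflect : ∫ v in R ⁻¹' A, ψ v ∂ν = ∫ v in A, ψ v ∂ν := by
    conv_rhs => rw [← hR.map_eq]
    rw [setIntegral_map hA hψ.aestronglyMeasurable hR.aemeasurable]
    simp_rw [hψR]
  rw [Measure.map_apply hb hA, ← measureReal_eq_measureReal_iff,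
    measureReal_preimage_of_sign hm hb (hR.measurable.comp hm) hy hby hA]
  change 2⁻¹ * ((_ + _) + (μ.real (a ⁻¹' (R ⁻¹' A)) - ∫ ω in a ⁻¹' (R ⁻¹' A), y ω ∂μ)) = _
  rw [hmeasure hA, hmeasure hRA, hintegral hA, hintegral hRA, hreflect,
    hR.measureReal_preimage hA.nullMeasurableSet]
  ring

end SignVariable

section SubGaussian

open scoped NNReal

variable {Ω : Type*} [MeasurableSpace Ω] {μ : Measure Ω} {X Z : Ω → ℝ}

theorem integrable_exp_mul_of_abs_le {t : ℝ} (hX : AEMeasurable X μ)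
    (hXZ : ∀ᵐ ω ∂μ, |X ω| ≤ |Z ω|) (hpos : Integrable (fun ω => Real.exp (t * Z ω)) μ)
    (hneg : Integrable (fun ω => Real.exp (-t * Z ω)) μ) :
    Integrable (fun ω => Real.exp (t * X ω)) μ := by
  refine (integrable_exp_abs_mul_abs hpos hneg).mono' (by fun_prop) ?_
  filter_upwards [hXZ] with ω hω
  rw [Real.norm_of_nonneg (Real.exp_pos _).le, Real.exp_le_exp]
  calc t * X ω ≤ |t| * |X ω| := by rw [← abs_mul]; exact le_abs_self _
    _ ≤ |t| * |Z ω| := by gcongr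

theorem exp_mul_integral_le_mgf [IsProbabilityMeasure μ] {t : ℝ} (hX : Integrable X μ)
    (hexp : Integrable (fun ω => Real.exp (t * X ω)) μ) :
    Real.exp (t * ∫ ω, X ω ∂μ) ≤ mgf X μ t := by
  rw [← integral_const_mul]
  exact convexOn_exp.map_integral_le Real.continuous_exp.continuousOn isClosed_univ
    (.of_forall fun _ => Set.mem_univ _) (hX.const_mul t) hexp

theorem mgf_add_mgf_neg_le_of_abs_le {t : ℝ} (hX : AEMeasurable X μ)
    (hXZ : ∀ᵐ ω ∂μ, |X ω| ≤ |Z ω|) (hpos : Integrable (fun ω => Real.exp (t * Z ω)) μ)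
    (hneg : Integrable (fun ω => Real.exp (-t * Z ω)) μ) :
    mgf X μ t + mgf X μ (-t) ≤ mgf Z μ t + mgf Z μ (-t) := by
  have hXpos := integrable_exp_mul_of_abs_le hX hXZ hpos hneg
  have hXneg := integrable_exp_mul_of_abs_le (t := -t) hX hXZ hneg (by rwa [neg_neg])
  rw [mgf, mgf, mgf, mgf, ← integral_add hXpos hXneg, ← integral_add hpos hneg]
  refine integral_mono_ae (hXpos.add hXneg) (hpos.add hneg) ?_
  filter_upwards [hXZ] with ω hω
  have hcosh : Real.cosh (t * X ω) ≤ Real.cosh (t * Z ω) := by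
    rw [Real.cosh_le_cosh, abs_mul, abs_mul]
    gcongr
  simp only [Real.cosh_eq, ← neg_mul] at hcosh
  exact (div_le_div_iff_of_pos_right two_pos).1 hcosh

theorem hasSubgaussianMGF_sub_integral_of_abs_le [IsProbabilityMeasure μ] {c : ℝ≥0}
    (hX : AEMeasurable X μ) (hZ : HasSubgaussianMGF Z c μ) (hXZ : ∀ᵐ ω ∂μ, |X ω| ≤ |Z ω|) :
    HasSubgaussianMGF (fun ω => X ω - ∫ ω', X ω' ∂μ) (2 * c) μ where
  integrable_exp_mul t := by
    simp_rw [mul_sub, Real.exp_sub]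
    exact (integrable_exp_mul_of_abs_le hX hXZ (hZ.integrable_exp_mul t)
      (hZ.integrable_exp_mul (-t))).div_const _
  mgf_le t := by
    have hexp : ∀ t, Integrable (fun ω => Real.exp (t * X ω)) μ := fun t =>
      integrable_exp_mul_of_abs_le hX hXZ (hZ.integrable_exp_mul t) (hZ.integrable_exp_mul (-t))
    have hXi : Integrable X μ := hZ.integrable.abs.mono' hX.aestronglyMeasurable hXZ
    -- Jensen turns the centering factor into the reflected moment generating function; the
    -- product of the two is then controlled by their sum, which is an expectation of `2 cosh`.
    calc mgf (fun ω => X ω - ∫ ω', X ω' ∂μ) μ t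
        = mgf X μ t * Real.exp (-t * ∫ ω, X ω ∂μ) := by
          simp_rw [sub_eq_add_neg, mgf_add_const, mul_neg, neg_mul]
      _ ≤ mgf X μ t * mgf X μ (-t) :=
          mul_le_mul_of_nonneg_left (exp_mul_integral_le_mgf hXi (hexp (-t))) mgf_nonneg
      _ ≤ ((mgf X μ t + mgf X μ (-t)) / 2) ^ 2 := by
          linarith [sq_nonneg ((mgf X μ t - mgf X μ (-t)) / 2)]
      _ ≤ ((mgf Z μ t + mgf Z μ (-t)) / 2) ^ 2 := by
          gcongr ?_ ^ 2
          · exact div_nonneg (add_nonneg mgf_nonneg mgf_nonneg) two_pos.le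
          · exact div_le_div_of_nonneg_right (mgf_add_mgf_neg_le_of_abs_le hX hXZ
              (hZ.integrable_exp_mul t) (hZ.integrable_exp_mul (-t))) two_pos.le
      _ ≤ Real.exp (c * t ^ 2 / 2) ^ 2 := by
          gcongr ?_ ^ 2
          · exact div_nonneg (add_nonneg mgf_nonneg mgf_nonneg) two_pos.le
          · linarith [hZ.mgf_le t, neg_sq t ▸ hZ.mgf_le (-t)]
      _ = Real.exp ((2 * c : ℝ≥0) * t ^ 2 / 2) := by
          rw [← Real.exp_nat_mul]
          push_cast
          ring_nf

theorem measureReal_sum_le_le_of_abs_le [IsProbabilityMeasure μ] {ι : Type*} [Fintype ι]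
    {X Z : ι → Ω → ℝ} {c : ℝ≥0} {l ε : ℝ} (hind : iIndepFun X μ) (hX : ∀ i, AEMeasurable (X i) μ)
    (hZ : ∀ i, HasSubgaussianMGF (Z i) c μ) (hXZ : ∀ i, ∀ᵐ ω ∂μ, |X i ω| ≤ |Z i ω|)
    (hl : ∀ i, ∫ ω, X i ω ∂μ = l) (hε : 0 ≤ ε) :
    μ.real {ω | ∑ i, X i ω ≤ Fintype.card ι * (l - ε)} ≤
      Real.exp (-(Fintype.card ι * ε ^ 2 / (4 * c))) := by
  have hsub : ∀ i ∈ Finset.univ, HasSubgaussianMGF (fun ω => -(X i ω - l)) (2 * c) μ :=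
    fun i _ => by
      simpa only [hl, Pi.neg_def] using
        (hasSubgaussianMGF_sub_integral_of_abs_le (hX i) (hZ i) (hXZ i)).neg
  have hindep : iIndepFun (fun i ω => -(X i ω - l)) μ :=
    hind.comp (fun _ r => -(r - l)) fun _ => by fun_prop
  have key := HasSubgaussianMGF.measure_sum_ge_le_of_iIndepFun hindep hsub
    (ε := Fintype.card ι * ε) (by positivity)
  refine Eq.trans_le ?_ (key.trans_eq ?_)
  · congr 1 with ω
    simp only [Set.mem_ofPred_eq, Finset.sum_neg_distrib, Finset.sum_sub_distrib, Finset.sum_const,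
      Finset.card_univ, nsmul_eq_mul]
    constructor <;> intro h <;> linarith
  · simp only [Finset.sum_const, Finset.card_univ, nsmul_eq_mul, NNReal.coe_mul,
      NNReal.coe_natCast, NNReal.coe_ofNat]
    congr 1
    rcases eq_or_ne (Fintype.card ι : ℝ) 0 with h0 | h0
    · simp [h0]
    · field_simp
      ring

theorem hasSubgaussianMGF_of_hasLaw_gaussianReal {v : ℝ≥0} (hX : HasLaw X (gaussianReal 0 v) μ) :
    HasSubgaussianMGF X v μ where
  integrable_exp_mul t := by
    have h := integrable_exp_mul_gaussianReal (μ := 0) (v := v) t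
    rw [← hX.map_eq] at h
    exact h.comp_aemeasurable hX.aemeasurable
  mgf_le t := by rw [mgf_gaussianReal hX.map_eq, zero_mul, zero_add]

end SubGaussian

section Excess

/-- The amount `(|z| - T)₊` by which `|z|` exceeds the level `T`, i.e. the absolute value of the
soft thresholding of `z`; it is the part of a Gaussian coordinate that the `ℓ¹` constraint does
not absorb. -/
def excess (T z : ℝ) : ℝ := max (|z| - T) 0

@[fun_prop]
theorem measurable_excess (T : ℝ) : Measurable (excess T) := by
  unfold excess
  fun_prop

theorem abs_le_excess_add (T z : ℝ) : |z| ≤ excess T z + T :=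
  sub_le_iff_le_add.1 (le_max_left _ _)

theorem exp_mul_excess_sq_le {t T : ℝ} (ht : 0 ≤ t) (hT : 0 ≤ T) (z : ℝ) :
    Real.exp (t * excess T z ^ 2) ≤ 1 + Real.exp (-t * T ^ 2) * Real.exp (t * z ^ 2) := by
  rcases le_total |z| T with h | h
  · rw [excess, max_eq_right (sub_nonpos.2 h)]
    rw [zero_pow two_ne_zero, mul_zero, Real.exp_zero]
    exact le_add_of_nonneg_right (by positivity)
  · have hsq : excess T z ^ 2 ≤ z ^ 2 - T ^ 2 := by
      rw [excess, max_eq_left (sub_nonneg.2 h), ← sq_abs z]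
      nlinarith
    calc Real.exp (t * excess T z ^ 2) ≤ Real.exp (t * (z ^ 2 - T ^ 2)) := by gcongr
      _ = Real.exp (-t * T ^ 2) * Real.exp (t * z ^ 2) := by rw [← Real.exp_add]; ring_nf
      _ ≤ 1 + Real.exp (-t * T ^ 2) * Real.exp (t * z ^ 2) := le_add_of_nonneg_left zero_le_one

theorem abs_inner_le_sqrt_sum_excess_sq_mul_norm_add {ι : Type*} [Fintype ι] (T : ℝ)
    (w z : EuclideanSpace ℝ ι) :
    |⟪w, z⟫| ≤ √(∑ j, excess T (w j) ^ 2) * ‖z‖ + T * ∑ j, |z j| := by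
  calc |⟪w, z⟫| ≤ ∑ j, |⟪w j, z j⟫| := by
        rw [PiLp.inner_apply]
        exact Finset.abs_sum_le_sum_abs _ _
    _ ≤ ∑ j, (excess T (w j) * |z j| + T * |z j|) := by
        refine Finset.sum_le_sum fun j _ => ?_
        rw [RCLike.inner_apply, conj_trivial, abs_mul, mul_comm, ← add_mul]
        exact mul_le_mul_of_nonneg_right (abs_le_excess_add T (w j)) (abs_nonneg _)
    _ ≤ √(∑ j, excess T (w j) ^ 2) * ‖z‖ + T * ∑ j, |z j| := by
        rw [Finset.sum_add_distrib, ← Finset.mul_sum, EuclideanSpace.norm_eq]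
        simp only [Real.norm_eq_abs]
        gcongr
        exact Real.sum_mul_le_sqrt_mul_sqrt _ _ _

theorem abs_inner_le_excess_of_mem_compressibleSet {n : ℕ} {s T : ℝ} (hT : 0 ≤ T)
    (w : EuclideanSpace ℝ (Fin n)) {z : EuclideanSpace ℝ (Fin n)} (hz : z ∈ compressibleSet n s) :
    |⟪w, z⟫| ≤ √(∑ j, excess T (w j) ^ 2) + T * √s := by
  calc |⟪w, z⟫| ≤ √(∑ j, excess T (w j) ^ 2) * ‖z‖ + T * ∑ j, |z j| :=
        abs_inner_le_sqrt_sum_excess_sq_mul_norm_add T w z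
    _ ≤ √(∑ j, excess T (w j) ^ 2) * 1 + T * √s := by
        gcongr
        exacts [hz.1, hz.2]
    _ = √(∑ j, excess T (w j) ^ 2) + T * √s := by rw [mul_one]

end Excess

section Gaussian

theorem gaussianPDFReal_mul_exp_mul_sq (t z : ℝ) :
    gaussianPDFReal 0 1 z * Real.exp (t * z ^ 2) =
      (√(2 * Real.pi))⁻¹ * Real.exp (-(1 / 2 - t) * z ^ 2) := by
  simp only [gaussianPDFReal, NNReal.coe_one, sub_zero, mul_one]
  rw [mul_assoc, ← Real.exp_add]
  ring_nf

theorem integrable_exp_mul_sq_gaussianReal {t : ℝ} (ht : t < 1 / 2) :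
    Integrable (fun z => Real.exp (t * z ^ 2)) (gaussianReal 0 1) := by
  rw [gaussianReal_of_var_ne_zero 0 one_ne_zero, integrable_withDensity_iff_integrable_smul'
    (by fun_prop) (.of_forall fun _ => gaussianPDF_lt_top)]
  simp only [toReal_gaussianPDF, smul_eq_mul, gaussianPDFReal_mul_exp_mul_sq]
  exact (integrable_exp_neg_mul_sq (sub_pos.2 ht)).const_mul _

theorem integral_exp_mul_sq_gaussianReal (t : ℝ) :
    ∫ z, Real.exp (t * z ^ 2) ∂(gaussianReal 0 1) = (√(1 - 2 * t))⁻¹ := by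
  rw [integral_gaussianReal_eq_integral_smul one_ne_zero]
  simp only [smul_eq_mul, gaussianPDFReal_mul_exp_mul_sq]
  have hπ : Real.pi / (1 / 2 - t) = (2 * Real.pi) * (1 - 2 * t)⁻¹ := by
    rw [show 1 / 2 - t = (1 - 2 * t) / 2 by ring, div_div_eq_mul_div, mul_comm Real.pi,
      div_eq_mul_inv]
  have hsqrt : √(2 * Real.pi) ≠ 0 := by positivity
  rw [integral_const_mul, integral_gaussian, hπ, Real.sqrt_mul Real.two_pi_pos.le (1 - 2 * t)⁻¹,
    Real.sqrt_inv (1 - 2 * t), inv_mul_cancel_left₀ hsqrt]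

theorem integrable_exp_mul_excess_sq_gaussianReal {t T : ℝ} (ht0 : 0 ≤ t) (ht : t < 1 / 2)
    (hT : 0 ≤ T) : Integrable (fun z => Real.exp (t * excess T z ^ 2)) (gaussianReal 0 1) := by
  refine ((integrable_const 1).add ((integrable_exp_mul_sq_gaussianReal ht).const_mul
    (Real.exp (-t * T ^ 2)))).mono' (by fun_prop) (.of_forall fun z => ?_)
  rw [Real.norm_of_nonneg (Real.exp_pos _).le]
  exact exp_mul_excess_sq_le ht0 hT z

theorem integral_exp_mul_excess_sq_gaussianReal_le {t T : ℝ} (ht0 : 0 ≤ t) (ht : t < 1 / 2)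
    (hT : 0 ≤ T) :
    ∫ z, Real.exp (t * excess T z ^ 2) ∂(gaussianReal 0 1) ≤
      Real.exp (Real.exp (-t * T ^ 2) * (√(1 - 2 * t))⁻¹) := by
  have hsq := (integrable_exp_mul_sq_gaussianReal ht).const_mul (Real.exp (-t * T ^ 2))
  calc ∫ z, Real.exp (t * excess T z ^ 2) ∂(gaussianReal 0 1)
      ≤ ∫ z, (1 + Real.exp (-t * T ^ 2) * Real.exp (t * z ^ 2)) ∂(gaussianReal 0 1) :=
        integral_mono (integrable_exp_mul_excess_sq_gaussianReal ht0 ht hT)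
          ((integrable_const 1).add hsq) (exp_mul_excess_sq_le ht0 hT)
    _ = Real.exp (-t * T ^ 2) * (√(1 - 2 * t))⁻¹ + 1 := by
        rw [integral_add (integrable_const 1) hsq, integral_const_mul,
          integral_exp_mul_sq_gaussianReal, integral_const, probReal_univ, one_smul, add_comm]
    _ ≤ Real.exp (Real.exp (-t * T ^ 2) * (√(1 - 2 * t))⁻¹) := Real.add_one_le_exp _

variable {Ω ι : Type*} [MeasurableSpace Ω] {μ : Measure Ω}

theorem measureReal_le_sum_excess_sq_le [IsProbabilityMeasure μ] [Fintype ι] {g : ι → Ω → ℝ}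
    (hind : iIndepFun g μ) (hgm : ∀ j, Measurable (g j))
    (hg : ∀ j, HasLaw (g j) (gaussianReal 0 1) μ) {t T : ℝ}
    (ht0 : 0 ≤ t) (ht : t < 1 / 2) (hT : 0 ≤ T) (r : ℝ) :
    μ.real {ω | r ≤ ∑ j, excess T (g j ω) ^ 2} ≤
      Real.exp (Fintype.card ι * (Real.exp (-t * T ^ 2) * (√(1 - 2 * t))⁻¹) - t * r) := by
  let X : ι → Ω → ℝ := fun j ω => excess T (g j ω) ^ 2
  have hX : ∀ j, Measurable (X j) := fun j => by fun_prop
  have hXind : iIndepFun X μ := hind.comp (fun _ z => excess T z ^ 2) fun _ => by fun_prop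
  have hexp : Measurable fun z => Real.exp (t * excess T z ^ 2) := by fun_prop
  have hint : ∀ j ∈ Finset.univ, Integrable (fun ω => Real.exp (t * X j ω)) μ := fun j _ => by
    have h := integrable_exp_mul_excess_sq_gaussianReal ht0 ht hT
    rw [← (hg j).map_eq] at h
    exact h.comp_aemeasurable (hg j).aemeasurable
  have hmgf : ∀ j, mgf (X j) μ t ≤ Real.exp (Real.exp (-t * T ^ 2) * (√(1 - 2 * t))⁻¹) := fun j =>
    ((hg j).integral_comp (f := fun z => Real.exp (t * excess T z ^ 2))
      hexp.aestronglyMeasurable).trans_le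
      (integral_exp_mul_excess_sq_gaussianReal_le ht0 ht hT)
  calc μ.real {ω | r ≤ ∑ j, excess T (g j ω) ^ 2}
      = μ.real {ω | r ≤ (∑ j, X j) ω} := by simp only [Finset.sum_apply, X]
    _ ≤ Real.exp (-t * r) * ∏ j, mgf (X j) μ t := by
        rw [← hXind.mgf_sum hX]
        exact measure_ge_le_exp_mul_mgf r ht0 (hXind.integrable_exp_mul_sum hX hint)
    _ ≤ Real.exp (-t * r) * ∏ _j : ι, Real.exp (Real.exp (-t * T ^ 2) * (√(1 - 2 * t))⁻¹) := by
        gcongr with j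
        · exact fun j _ => mgf_nonneg
        · exact hmgf j
    _ = Real.exp (Fintype.card ι * (Real.exp (-t * T ^ 2) * (√(1 - 2 * t))⁻¹) - t * r) := by
        rw [Finset.prod_const, Finset.card_univ, ← Real.exp_nat_mul, ← Real.exp_add]
        ring_nf

theorem hasLaw_ofLp_of_hasLaw_stdGaussian [Fintype ι] {W : Ω → EuclideanSpace ℝ ι}
    (hW : HasLaw W (stdGaussian (EuclideanSpace ℝ ι)) μ) :
    HasLaw (fun ω => (W ω).ofLp) (Measure.pi fun _ : ι => gaussianReal 0 1) μ := by
  refine HasLaw.fun_comp (Y := WithLp.ofLp) ⟨by fun_prop, ?_⟩ hW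
  rw [← map_pi_eq_stdGaussian, Measure.map_map (by fun_prop) (by fun_prop)]
  exact Measure.map_id

theorem hasLaw_apply_of_hasLaw_stdGaussian [Fintype ι] {W : Ω → EuclideanSpace ℝ ι}
    (hW : HasLaw W (stdGaussian (EuclideanSpace ℝ ι)) μ) (j : ι) :
    HasLaw (fun ω => W ω j) (gaussianReal 0 1) μ :=
  (measurePreserving_eval (fun _ : ι => gaussianReal 0 1) j).hasLaw.fun_comp
    (hasLaw_ofLp_of_hasLaw_stdGaussian hW)

theorem iIndepFun_apply_of_hasLaw_stdGaussian [IsProbabilityMeasure μ] [Fintype ι]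
    {W : Ω → EuclideanSpace ℝ ι} (hW : HasLaw W (stdGaussian (EuclideanSpace ℝ ι)) μ) :
    iIndepFun (fun j ω => W ω j) μ :=
  (iIndepFun_iff_hasLaw_pi_pi (hasLaw_apply_of_hasLaw_stdGaussian hW)).2
    (hasLaw_ofLp_of_hasLaw_stdGaussian hW)

theorem exp_neg_sqrt_log_sq_le {r : ℝ} (hr : 0 < r) : Real.exp (-√(Real.log r) ^ 2) ≤ r⁻¹ := by
  rw [← Real.exp_log (inv_pos.2 hr), Real.log_inv, Real.exp_le_exp, neg_le_neg_iff]
  rcases le_total 0 (Real.log r) with h | h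
  · rw [Real.sq_sqrt h]
  · exact h.trans (sq_nonneg _)

theorem measureReal_exists_compressibleSet_lt_abs_inner_le [IsProbabilityMeasure μ] {n : ℕ}
    {W : Ω → EuclideanSpace ℝ (Fin n)} (hWm : Measurable W)
    (hW : HasLaw W (stdGaussian (EuclideanSpace ℝ (Fin n))) μ) {s u : ℝ} (hs : 0 < s)
    (hu : 0 ≤ u) :
    μ.real {ω | ∃ z ∈ compressibleSet n s, 2 * √(s * Real.log (2 * n / s)) + u < |⟪W ω, z⟫|} ≤
      Real.exp (s - u ^ 2 / 4) := by
  let T := 2 * √(Real.log (2 * n / s))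
  have hsubset : {ω | ∃ z ∈ compressibleSet n s,
      2 * √(s * Real.log (2 * n / s)) + u < |⟪W ω, z⟫|} ⊆
      {ω | u ^ 2 ≤ ∑ j, excess T (W ω j) ^ 2} := by
    rintro ω ⟨z, hz, hlt⟩
    have hT : T * √s = 2 * √(s * Real.log (2 * n / s)) := by
      rw [Real.sqrt_mul hs.le]
      ring
    have h := abs_inner_le_excess_of_mem_compressibleSet (T := T) (by positivity) (W ω) hz
    exact (Real.le_sqrt hu (by positivity)).1 (by linarith)
  -- The level `T` is chosen so that the expected number of exceedances is at most of order `s`.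
  have hlevel : n * (Real.exp (-(1 / 4) * T ^ 2) * (√(1 - 2 * (1 / 4)))⁻¹) ≤ s := by
    rcases n.eq_zero_or_pos with rfl | hn
    · simpa only [Nat.cast_zero, zero_mul] using hs.le
    have hexp : Real.exp (-(1 / 4) * T ^ 2) ≤ (2 * n / s)⁻¹ := by
      rw [show -(1 / 4) * T ^ 2 = -√(Real.log (2 * n / s)) ^ 2 by ring]
      exact exp_neg_sqrt_log_sq_le (by positivity)
    have hsqrt : (√(1 - 2 * (1 / 4)))⁻¹ ≤ 2 := by
      rw [inv_le_comm₀ (by norm_num) two_pos]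
      exact Real.le_sqrt_of_sq_le (by norm_num)
    calc n * (Real.exp (-(1 / 4) * T ^ 2) * (√(1 - 2 * (1 / 4)))⁻¹)
        ≤ n * ((2 * n / s)⁻¹ * 2) := by gcongr
      _ = s := by field_simp
  calc _ ≤ μ.real {ω | u ^ 2 ≤ ∑ j, excess T (W ω j) ^ 2} := measureReal_mono hsubset
    _ ≤ Real.exp (Fintype.card (Fin n) * (Real.exp (-(1 / 4) * T ^ 2) *
          (√(1 - 2 * (1 / 4)))⁻¹) - 1 / 4 * u ^ 2) :=
        measureReal_le_sum_excess_sq_le (iIndepFun_apply_of_hasLaw_stdGaussian hW)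
          (fun j => by fun_prop) (hasLaw_apply_of_hasLaw_stdGaussian hW) (by norm_num)
          (by norm_num) (by positivity) (u ^ 2)
    _ ≤ Real.exp (s - u ^ 2 / 4) := by
        rw [Fintype.card_fin]
        exact Real.exp_le_exp.2 (by linarith)

section StdGaussian

variable {E : Type*} [NormedAddCommGroup E] [InnerProductSpace ℝ E] [FiniteDimensional ℝ E]
  [MeasurableSpace E] [BorelSpace E]

theorem hasLaw_inner_stdGaussian {x : E} (hx : ‖x‖ = 1) :
    HasLaw (fun v : E => ⟪v, x⟫) (gaussianReal 0 1) (stdGaussian E) := by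
  refine ⟨by fun_prop, ?_⟩
  have hmap := IsGaussian.map_eq_gaussianReal (μ := stdGaussian E) (innerSL ℝ x)
  rw [integral_strongDual_stdGaussian, variance_dual_stdGaussian, innerSL_apply_norm, hx,
    one_pow, Real.toNNReal_one] at hmap
  rw [← hmap]
  exact Measure.map_congr (.of_forall fun v => real_inner_comm x v)

theorem hasLaw_inv_sqrt_smul_sum_stdGaussian [Fintype ι] [Nonempty ι] {b : ι → Ω → E}
    (hind : iIndepFun b μ) (hlaw : ∀ i, HasLaw (b i) (stdGaussian E) μ) :
    HasLaw (fun ω => (√(Fintype.card ι))⁻¹ • ∑ i, b i ω) (stdGaussian E) μ := by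
  have := hind.isProbabilityMeasure
  have hb : ∀ i, AEMeasurable (b i) μ := fun i => (hlaw i).aemeasurable
  have hsum : AEMeasurable (fun ω => ∑ i, b i ω) μ :=
    Finset.aemeasurable_fun_sum _ fun i _ => hb i
  refine ⟨hsum.const_smul _, Measure.ext_of_charFun (funext fun t => ?_)⟩
  have hcard : (0 : ℝ) < Fintype.card ι := by exact_mod_cast Fintype.card_pos
  have hscale : Fintype.card ι * ‖(√(Fintype.card ι))⁻¹ • t‖ ^ 2 = ‖t‖ ^ 2 := by
    rw [norm_smul, mul_pow, Real.norm_eq_abs, sq_abs, inv_pow, Real.sq_sqrt hcard.le,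
      mul_inv_cancel_left₀ hcard.ne']
  rw [charFun_map_smul_comp hsum, hind.charFun_map_fun_sum_eq_prod hb, Finset.prod_apply]
  simp only [(hlaw _).map_eq, charFun_stdGaussian]
  rw [Finset.prod_const, ← Complex.exp_nat_mul, Finset.card_univ, ← mul_div_assoc, mul_neg]
  norm_cast
  rw [hscale]

end StdGaussian

end Gaussian

section FlipOrthogonal

variable {ι E : Type*} [NormedAddCommGroup E] [InnerProductSpace ℝ E] {x : E}

/-- The vector `v` with its component orthogonal to the unit vector `x` multiplied by `b`.
Multiplying by a sign `b` removes the dependence of the objective of the convex program on the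
responses in all directions orthogonal to the signal. -/
noncomputable def flipOrthogonal (x v : E) (b : ℝ) : E := ⟪v, x⟫ • x + b • (v - ⟪v, x⟫ • x)

theorem measurable_flipOrthogonal [MeasurableSpace E] [BorelSpace E] [SecondCountableTopology E]
    {Ω : Type*} [MeasurableSpace Ω] {v : Ω → E} {b : Ω → ℝ} (hv : Measurable v)
    (hb : Measurable b) : Measurable fun ω => flipOrthogonal x (v ω) (b ω) := by
  unfold flipOrthogonal
  fun_prop

theorem flipOrthogonal_one (x v : E) : flipOrthogonal x v 1 = v := by
  rw [flipOrthogonal, one_smul, add_sub_cancel]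

theorem flipOrthogonal_neg_one (hx : ‖x‖ = 1) (v : E) :
    flipOrthogonal x v (-1) = (ℝ ∙ x).reflection v := by
  rw [Submodule.reflection_singleton_apply, hx, real_inner_comm]
  simp only [flipOrthogonal, RCLike.ofReal_one, one_pow, div_one]
  module

theorem inner_flipOrthogonal_self (hx : ‖x‖ = 1) (v : E) (b : ℝ) :
    ⟪flipOrthogonal x v b, x⟫ = ⟪v, x⟫ := by
  simp only [flipOrthogonal, inner_add_left, inner_sub_left, real_inner_smul_left,
    real_inner_self_eq_norm_sq, hx, one_pow, mul_one, sub_self, mul_zero, add_zero]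

theorem mul_inner_eq_add_inner_flipOrthogonal (hx : ‖x‖ = 1) (v z : E) (b : ℝ) :
    b * ⟪v, z⟫ = b * ⟪v, x⟫ * ⟪x, z⟫ +
      (⟪flipOrthogonal x v b, z⟫ - ⟪flipOrthogonal x v b, x⟫ * ⟪x, z⟫) := by
  rw [inner_flipOrthogonal_self hx]
  simp only [flipOrthogonal, inner_add_left, inner_sub_left, real_inner_smul_left]
  ring

theorem sum_mul_inner_eq_add_inner_sum_flipOrthogonal [Fintype ι] (hx : ‖x‖ = 1) (v : ι → E)
    (b : ι → ℝ) (z : E) :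
    ∑ i, b i * ⟪v i, z⟫ = (∑ i, b i * ⟪v i, x⟫) * ⟪x, z⟫ +
      (⟪∑ i, flipOrthogonal x (v i) (b i), z⟫ -
        ⟪∑ i, flipOrthogonal x (v i) (b i), x⟫ * ⟪x, z⟫) := by
  rw [sum_inner, sum_inner, Finset.sum_mul, Finset.sum_mul, ← Finset.sum_sub_distrib,
    ← Finset.sum_add_distrib]
  exact Finset.sum_congr rfl fun i _ => mul_inner_eq_add_inner_flipOrthogonal hx (v i) z (b i)

theorem norm_sub_sq_le_two_mul_one_sub_inner (hx : ‖x‖ = 1) {z : E} (hz : ‖z‖ ≤ 1) :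
    ‖z - x‖ ^ 2 ≤ 2 * (1 - ⟪x, z⟫) := by
  have hz2 : ‖z‖ ^ 2 ≤ 1 := pow_le_one₀ (norm_nonneg z) hz
  rw [norm_sub_sq_real, hx, real_inner_comm]
  linarith

theorem mul_norm_sub_sq_le_of_sum_mul_inner_le [Fintype ι] (hx : ‖x‖ = 1) {z : E} (hz : ‖z‖ ≤ 1)
    {v : ι → E} {b : ι → ℝ} {l ρ η : ℝ} (hl : 0 ≤ l) (hρ : 0 ≤ ρ)
    (hopt : ∑ i, b i * ⟪v i, x⟫ ≤ ∑ i, b i * ⟪v i, z⟫)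
    (hcorr : l - ρ ≤ ∑ i, b i * ⟪v i, x⟫)
    (hwx : |⟪∑ i, flipOrthogonal x (v i) (b i), x⟫| ≤ η)
    (hwz : |⟪∑ i, flipOrthogonal x (v i) (b i), z⟫| ≤ η) :
    l * ‖z - x‖ ^ 2 ≤ 4 * (η + ρ) := by
  set w := ∑ i, flipOrthogonal x (v i) (b i)
  set S := ∑ i, b i * ⟪v i, x⟫
  have hq : |⟪x, z⟫| ≤ 1 := (abs_real_inner_le_norm x z).trans (by rwa [hx, one_mul])
  have hwq : |⟪w, x⟫ * ⟪x, z⟫| ≤ η := by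
    rw [abs_mul]
    exact (mul_le_of_le_one_right (abs_nonneg _) hq).trans hwx
  have hgap : S * (1 - ⟪x, z⟫) ≤ 2 * η := by
    rw [sum_mul_inner_eq_add_inner_sum_flipOrthogonal hx v b z] at hopt
    linarith [(abs_le.1 hwz).2, (abs_le.1 hwq).1]
  have hq0 : 0 ≤ 1 - ⟪x, z⟫ := sub_nonneg.2 (abs_le.1 hq).2
  have hq2 : 1 - ⟪x, z⟫ ≤ 2 := by linarith [(abs_le.1 hq).1]
  calc l * ‖z - x‖ ^ 2 ≤ l * (2 * (1 - ⟪x, z⟫)) := by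
        gcongr
        exact norm_sub_sq_le_two_mul_one_sub_inner hx hz
    _ = 2 * ((l - ρ) * (1 - ⟪x, z⟫) + ρ * (1 - ⟪x, z⟫)) := by ring
    _ ≤ 2 * (S * (1 - ⟪x, z⟫) + ρ * 2) := by gcongr
    _ ≤ 4 * (η + ρ) := by linarith

end FlipOrthogonal

section Program

variable {n m : ℕ} {s : ℝ} {x : EuclideanSpace ℝ (Fin n)} {v : Fin m → EuclideanSpace ℝ (Fin n)}
  {b : Fin m → ℝ}

theorem isCompact_compressibleSet (n : ℕ) (s : ℝ) : IsCompact (compressibleSet n s) := by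
  refine Metric.isCompact_of_isClosed_isBounded ?_ ?_
  · exact (isClosed_le continuous_norm continuous_const).inter
      (isClosed_le (f := fun x : EuclideanSpace ℝ (Fin n) => ∑ j, |x j|) (by fun_prop)
        continuous_const)
  · exact Metric.isBounded_closedBall.subset fun x hx => mem_closedBall_zero_iff.2 hx.1

theorem exists_isProgramSolution (hx : x ∈ compressibleSet n s)
    (v : Fin m → EuclideanSpace ℝ (Fin n)) (b : Fin m → ℝ) :
    ∃ xhat, IsProgramSolution s v b xhat :=
  (isCompact_compressibleSet n s).exists_isMaxOn ⟨x, hx⟩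
    (f := fun x' => ∑ i, b i * ⟪v i, x'⟫) (by fun_prop)

theorem IsProgramSolution.norm_sub_sq_le_div {xhat : EuclideanSpace ℝ (Fin n)}
    (hsol : IsProgramSolution s v b xhat) (hx : x ∈ compressibleSet n s) (hx1 : ‖x‖ = 1)
    {l δ : ℝ} (hm : 0 < m) (hl : 0 < l) (hδ : 0 ≤ δ)
    (hcorr : m * (l - δ / 8) ≤ ∑ i, b i * ⟪v i, x⟫)
    (hw : ∀ z ∈ compressibleSet n s, |⟪∑ i, flipOrthogonal x (v i) (b i), z⟫| ≤ m * (δ / 8)) :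
    ‖xhat - x‖ ^ 2 ≤ δ / l := by
  have hm' : (0 : ℝ) < m := Nat.cast_pos.2 hm
  have h : m * l * ‖xhat - x‖ ^ 2 ≤ 4 * (m * (δ / 8) + m * (δ / 8)) :=
    mul_norm_sub_sq_le_of_sum_mul_inner_le hx1 hsol.1.1 (by positivity) (by positivity)
      (hsol.2 hx) (by rwa [← mul_sub]) (hw x hx) (hw xhat hsol.1)
  rw [le_div_iff₀ hl]
  exact le_of_mul_le_mul_left (by linarith) hm'

end Program

theorem half_le_log_two_mul_div {s r : ℝ} (hs : 0 < s) (hsr : s ≤ r) :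
    1 / 2 ≤ Real.log (2 * r / s) := by
  have htwo : 2 ≤ 2 * r / s := (le_div_iff₀ hs).2 (by gcongr)
  linarith [Real.log_le_log two_pos htwo, Real.log_two_gt_d9]

theorem measurable_measurementSigma {Ω : Type*} {n m : ℕ}
    (a : Fin m → Ω → EuclideanSpace ℝ (Fin n)) (i : Fin m) : Measurable[measurementSigma a] (a i) :=
  (measurable_pi_apply i).comp (comap_measurable fun ω i => a i ω)

namespace IsOneBitModel

variable {Ω : Type*} [MeasurableSpace Ω] {μ : Measure Ω} {n m : ℕ} {θ : ℝ → ℝ}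
  {x : EuclideanSpace ℝ (Fin n)} {a : Fin m → Ω → EuclideanSpace ℝ (Fin n)} {y : Fin m → Ω → ℝ}

theorem measurementSigma_le (h : IsOneBitModel μ θ x a y) :
    measurementSigma a ≤ ‹MeasurableSpace Ω› :=
  (measurable_pi_lambda _ h.measurable_a).comap_le

theorem hasLaw_inner (h : IsOneBitModel μ θ x a y) (hx : ‖x‖ = 1) (i : Fin m) :
    HasLaw (fun ω => ⟪a i ω, x⟫) (gaussianReal 0 1) μ :=
  (hasLaw_inner_stdGaussian hx).fun_comp (h.law_a i)

theorem measurable_mul_inner (h : IsOneBitModel μ θ x a y) (i : Fin m) :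
    Measurable fun ω => y i ω * ⟪a i ω, x⟫ := by
  have ha := h.measurable_a i
  have hy := h.measurable_y i
  fun_prop

theorem abs_mul_inner_le (h : IsOneBitModel μ θ x a y) (i : Fin m) :
    ∀ᵐ ω ∂μ, |y i ω * ⟪a i ω, x⟫| ≤ |⟪a i ω, x⟫| := by
  filter_upwards [h.sign_y i] with ω hω
  rcases hω with hω | hω <;> simp [hω]

variable [IsProbabilityMeasure μ]

theorem iIndepFun_prodMk (h : IsOneBitModel μ θ x a y) (hθ : Measurable θ) :
    iIndepFun (fun i ω => (a i ω, y i ω)) μ := by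
  refine h.condIndep_y.iIndepFun_prodMk h.measurementSigma_le (measurable_measurementSigma a)
    h.indep_a h.measurable_y fun i B _ => ?_
  obtain ⟨p, q, hpq⟩ := condExp_indicator_preimage_of_sign h.measurementSigma_le
    (h.measurable_y i) (h.sign_y i) B
  refine ⟨fun v => p + q * θ ⟪v, x⟫, by fun_prop, ?_⟩
  filter_upwards [hpq, h.condMean_y i] with ω hω hmean
  rw [hω, hmean]

theorem integral_mul_inner (h : IsOneBitModel μ θ x a y) (hθ : Measurable θ) (hx : ‖x‖ = 1)
    (i : Fin m) : ∫ ω, y i ω * ⟪a i ω, x⟫ ∂μ = linkCorrelation θ := by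
  have hg := hasSubgaussianMGF_of_hasLaw_gaussianReal (h.hasLaw_inner hx i)
  have hmeas : Measurable[measurementSigma a] fun ω => ⟪a i ω, x⟫ :=
    Measurable.comp (g := fun v => ⟪v, x⟫) (by fun_prop) (measurable_measurementSigma a i)
  rw [integral_mul_eq_integral_mul_of_condExp_ae_eq h.measurementSigma_le (h.condMean_y i)
    hmeas.stronglyMeasurable (integrable_of_sign (h.measurable_y i) (h.sign_y i))
    (hg.integrable.abs.mono' (h.measurable_mul_inner i).aestronglyMeasurable
      (h.abs_mul_inner_le i))]
  exact (h.hasLaw_inner hx i).integral_comp (f := fun z => θ z * z) (by fun_prop)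

theorem measureReal_sum_mul_inner_le (h : IsOneBitModel μ θ x a y) (hθ : Measurable θ)
    (hx : ‖x‖ = 1) {ε : ℝ} (hε : 0 ≤ ε) :
    μ.real {ω | ∑ i, y i ω * ⟪a i ω, x⟫ ≤ m * (linkCorrelation θ - ε)} ≤
      Real.exp (-(m * ε ^ 2 / 4)) := by
  have hind : iIndepFun (fun i ω => y i ω * ⟪a i ω, x⟫) μ :=
    (h.iIndepFun_prodMk hθ).comp (fun _ p => p.2 * ⟪p.1, x⟫) fun _ => by fun_prop
  simpa only [Fintype.card_fin, NNReal.coe_one, mul_one] using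
    measureReal_sum_le_le_of_abs_le hind (fun i => (h.measurable_mul_inner i).aemeasurable)
      (fun i => hasSubgaussianMGF_of_hasLaw_gaussianReal (h.hasLaw_inner hx i))
      h.abs_mul_inner_le (h.integral_mul_inner hθ hx) hε

theorem hasLaw_flipOrthogonal (h : IsOneBitModel μ θ x a y) (hθ : Measurable θ) (hx : ‖x‖ = 1)
    (i : Fin m) :
    HasLaw (fun ω => flipOrthogonal x (a i ω) (y i ω)) (stdGaussian (EuclideanSpace ℝ (Fin n)))
      μ := by
  refine hasLaw_of_sign_of_measurePreserving (R := (ℝ ∙ x).reflection)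
    (ψ := fun v => θ ⟪v, x⟫) h.measurementSigma_le (measurable_measurementSigma a i) (h.law_a i)
    (h.measurable_y i) (measurable_flipOrthogonal (h.measurable_a i) (h.measurable_y i))
    (by fun_prop) (h.condMean_y i)
    ⟨(ℝ ∙ x).reflection.continuous.measurable, stdGaussian_map _⟩ (fun v => ?_) ?_
  · rw [← flipOrthogonal_neg_one hx, inner_flipOrthogonal_self hx]
  · filter_upwards [h.sign_y i] with ω hω
    rcases hω with hω | hω
    · exact .inr ⟨hω, by rw [hω, flipOrthogonal_neg_one hx]⟩
    · exact .inl ⟨hω, by rw [hω, flipOrthogonal_one]⟩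

theorem hasLaw_inv_sqrt_smul_sum_flipOrthogonal (h : IsOneBitModel μ θ x a y) (hθ : Measurable θ)
    (hx : ‖x‖ = 1) (hm : 0 < m) :
    HasLaw (fun ω => (√m)⁻¹ • ∑ i, flipOrthogonal x (a i ω) (y i ω))
      (stdGaussian (EuclideanSpace ℝ (Fin n))) μ := by
  have : Nonempty (Fin m) := Fin.pos_iff_nonempty.1 hm
  have hind : iIndepFun (fun i ω => flipOrthogonal x (a i ω) (y i ω)) μ :=
    (h.iIndepFun_prodMk hθ).comp (fun _ p => flipOrthogonal x p.1 p.2)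
      fun _ => measurable_flipOrthogonal measurable_fst measurable_snd
  simpa only [Fintype.card_fin] using
    hasLaw_inv_sqrt_smul_sum_stdGaussian hind (h.hasLaw_flipOrthogonal hθ hx)

theorem measureReal_exists_lt_abs_inner_sum_flipOrthogonal_le (h : IsOneBitModel μ θ x a y)
    (hθ : Measurable θ) (hx : ‖x‖ = 1) (hm : 0 < m) {s u : ℝ} (hs : 0 < s) (hu : 0 ≤ u) :
    μ.real {ω | ∃ z ∈ compressibleSet n s, √m * (2 * √(s * Real.log (2 * n / s)) + u) <
      |⟪∑ i, flipOrthogonal x (a i ω) (y i ω), z⟫|} ≤ Real.exp (s - u ^ 2 / 4) := by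
  have hflip : ∀ i, Measurable fun ω => flipOrthogonal x (a i ω) (y i ω) := fun i =>
    measurable_flipOrthogonal (h.measurable_a i) (h.measurable_y i)
  refine le_of_eq_of_le ?_ (measureReal_exists_compressibleSet_lt_abs_inner_le
    (by fun_prop) (h.hasLaw_inv_sqrt_smul_sum_flipOrthogonal hθ hx hm) hs hu)
  have hsqrt : 0 < √(m : ℝ) := Real.sqrt_pos.2 (Nat.cast_pos.2 hm)
  simp only [real_inner_smul_left, abs_mul, abs_of_pos (inv_pos.2 hsqrt),
    lt_inv_mul_iff₀ hsqrt]

theorem measureReal_exists_mul_div_lt_abs_inner_sum_flipOrthogonal_le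
    (h : IsOneBitModel μ θ x a y) (hθ : Measurable θ) (hx : ‖x‖ = 1) (hm : 0 < m) {s δ : ℝ}
    (hs : 0 < s) (hsn : s ≤ n) (hδ : 0 < δ)
    (hsample : 4096 * (s * Real.log (2 * n / s)) ≤ δ ^ 2 * m) :
    μ.real {ω | ∃ z ∈ compressibleSet n s, m * (δ / 8) <
      |⟪∑ i, flipOrthogonal x (a i ω) (y i ω), z⟫|} ≤ Real.exp (-(1 / 2048 * δ ^ 2 * m)) := by
  have hlog : 1 / 2 ≤ Real.log (2 * n / s) := half_le_log_two_mul_div hs hsn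
  have hmm : √(m : ℝ) * √m = m := Real.mul_self_sqrt (Nat.cast_nonneg m)
  have hwidth : √(s * Real.log (2 * n / s)) ≤ √m * (δ / 64) := by
    refine Real.sqrt_le_iff.2 ⟨by positivity, ?_⟩
    rw [mul_pow, sq √(m : ℝ), hmm]
    linarith
  have hlevel : √m * (2 * √(s * Real.log (2 * n / s)) + √m * (δ / 16)) ≤ m * (δ / 8) := calc
    _ ≤ √m * (√m * (δ / 8)) := by
        gcongr
        have : 0 ≤ √m * δ := by positivity
        linarith
    _ = m * (δ / 8) := by rw [← mul_assoc, hmm]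
  calc _ ≤ μ.real {ω | ∃ z ∈ compressibleSet n s,
          √m * (2 * √(s * Real.log (2 * n / s)) + √m * (δ / 16)) <
            |⟪∑ i, flipOrthogonal x (a i ω) (y i ω), z⟫|} :=
        measureReal_mono (Set.ofPred_subset_ofPred.2 fun ω ⟨z, hz, hlt⟩ =>
          ⟨z, hz, hlevel.trans_lt hlt⟩)
    _ ≤ Real.exp (s - (√m * (δ / 16)) ^ 2 / 4) :=
        h.measureReal_exists_lt_abs_inner_sum_flipOrthogonal_le hθ hx hm hs (by positivity)
    _ ≤ Real.exp (-(1 / 2048 * δ ^ 2 * m)) := by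
        rw [mul_pow, sq √(m : ℝ), hmm, Real.exp_le_exp]
        linarith [mul_le_mul_of_nonneg_left hlog hs.le]

end IsOneBitModel

theorem exists_measurableSet_one_sub_add_le_measureReal {Ω : Type*} [MeasurableSpace Ω]
    {μ : Measure Ω} [IsProbabilityMeasure μ] {A B : Set Ω} {p q : ℝ} (hA : μ.real A ≤ p)
    (hB : μ.real B ≤ q) :
    ∃ E, MeasurableSet E ∧ 1 - (p + q) ≤ μ.real E ∧ ∀ ω ∈ E, ω ∉ A ∧ ω ∉ B := by
  refine ⟨(toMeasurable μ (A ∪ B))ᶜ, (measurableSet_toMeasurable _ _).compl, ?_, fun ω hω => ?_⟩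
  · rw [probReal_compl_eq_one_sub (measurableSet_toMeasurable _ _), measureReal_def,
      measure_toMeasurable, ← measureReal_def]
    linarith [measureReal_union_le (μ := μ) A B]
  · exact not_or.1 fun hmem => hω (subset_toMeasurable μ _ hmem)

theorem mainTheorem4 :
    ∃ C c : ℝ, 0 < C ∧ 0 < c ∧
      ∀ (Ω : Type*) [MeasurableSpace Ω] (μ : Measure Ω) [IsProbabilityMeasure μ]
        (n m : ℕ) (s δ : ℝ) (θ : ℝ → ℝ) (x : EuclideanSpace ℝ (Fin n))
        (a : Fin m → Ω → EuclideanSpace ℝ (Fin n)) (y : Fin m → Ω → ℝ),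
        0 < s → s ≤ n → 0 < δ → Measurable θ → 0 < linkCorrelation θ →
        x ∈ compressibleSet n s → ‖x‖ = 1 →
        IsOneBitModel μ θ x a y →
        C * δ⁻¹ ^ 2 * (s * Real.log (2 * n / s)) ≤ m →
        ∃ E : Set Ω, MeasurableSet E ∧ 1 - 8 * Real.exp (-(c * δ ^ 2 * m)) ≤ μ.real E ∧
          ∀ ω ∈ E,
            (∃ xhat, IsProgramSolution s (fun i => a i ω) (fun i => y i ω) xhat) ∧
            ∀ xhat, IsProgramSolution s (fun i => a i ω) (fun i => y i ω) xhat →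
              ‖xhat - x‖ ^ 2 ≤ δ / linkCorrelation θ := by
  refine ⟨4096, 1 / 2048, by norm_num, by norm_num, ?_⟩
  intro Ω _ μ _ n m s δ θ x a y hs hsn hδ hθ hl hxK hx hmodel hsample
  have hsample' : 4096 * (s * Real.log (2 * n / s)) ≤ δ ^ 2 * m := by
    rwa [mul_right_comm, inv_pow, ← div_eq_mul_inv, div_le_iff₀' (by positivity)] at hsample
  have hlog : 0 < Real.log (2 * n / s) := one_half_pos.trans_le (half_le_log_two_mul_div hs hsn)
  have hpos : 0 < δ ^ 2 * (m : ℝ) := lt_of_lt_of_le (by positivity) hsample'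
  have hm : 0 < m := Nat.cast_pos.1 (pos_of_mul_pos_right hpos (sq_nonneg δ))
  have hcorr := hmodel.measureReal_sum_mul_inner_le hθ hx (ε := δ / 8) (by positivity)
  have hwidth := hmodel.measureReal_exists_mul_div_lt_abs_inner_sum_flipOrthogonal_le hθ hx hm hs
    hsn hδ hsample'
  obtain ⟨E, hE, hprob, hgood⟩ := exists_measurableSet_one_sub_add_le_measureReal hcorr hwidth
  refine ⟨E, hE, le_trans ?_ hprob, fun ω hω => ⟨exists_isProgramSolution hxK _ _,
    fun xhat hsol => ?_⟩⟩
  · have hrate : Real.exp (-(m * (δ / 8) ^ 2 / 4)) ≤ Real.exp (-(1 / 2048 * δ ^ 2 * m)) :=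
      Real.exp_le_exp.2 (by nlinarith [show 0 ≤ m * δ ^ 2 by positivity])
    linarith [Real.exp_pos (-(1 / 2048 * δ ^ 2 * m))]
  · obtain ⟨hωcorr, hωwidth⟩ := hgood ω hω
    exact hsol.norm_sub_sq_le_div hxK hx hm hl hδ.le (not_le.1 hωcorr).le
      fun z hz => not_lt.1 fun hlt => hωwidth ⟨z, hz, hlt⟩
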